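/- **Setting.** Let $m\in\{2,3\}$ and let $\Omega\subset\mathbb R^m$ be a bounded open set (for instance a bounded Lipschitz domain). Let $\nu,\lambda,\gamma,\varepsilon,T>0$, let $N\ge 1$ be an integer, $\Delta t=T/N$ and $t^n=n\Delta t$. $(\cdot,\cdot)$ and $\|\cdot\|$ are the $L^2(\Omega)$ inner product and norm of scalar, vector or tensor fields, and all derivatives are weak derivatives. We write $(\nabla v)_{ij}=\partial_iv_j$, $((a\cdot\nabla)b)_j=\sum_i a_i\partial_i b_j$, $((\nabla d)^tw)_i=\sum_j(\partial_i d_j)w_j$, $\tilde f^{n+1}=2f^n-f^{n-1}$ for $f=u,d,w$, and $K^{n+1}=s^{n+1}/\exp(-t^{n+1}/T)$. **Scheme (PCSAV-ECT).** Consider vector fields $u^n,d^n,w^n$ on $\Omega$ with values in $\mathbb R^m$, scalar fields $p^n,q^n$ and numbers $s^n$ ($0\le n\le N$), and vector fields $u_*^n$ ($1\le n\le N$), such that $u^n,w^n,p^n,q^n\in L^2(\Omega)$, $d^n\in H^1(\Omega)^m$, $u_*^n\in H^1_0(\Omega)^m$, and $u^n$ has locally integrable weak derivatives with $\nabla\cdot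 u^n=0$ and $u^n\cdot\mathbf n|_{\partial\Omega}=0$, where the latter means $(u^n,\nabla\psi)+(\nabla\cdot u^n,\psi)=0$ for all $\psi\in H^1(\Omega)$. The values at the levels $0$ and $1$ (for $u_*$ at the level $1$; e.g. $u_*^1=u^1$) are arbitrary starting values with $p^1+\nu\nabla\cdot u_*^1\in H^1(\Omega)$. For every $1\le n<N$ the following holds. 1. $\displaystyle \frac{3d^{n+1}-4d^n+d^{n-1}}{2\Delta t}+K^{n+1}\,(\tilde u^{n+1}\cdot\nabla)\tilde d^{n+1}+\gamma w^{n+1}=0$ a.e. in $\Omega$. 2. $w^{n+1}=-\Delta d^{n+1}+q^{n+1}\tilde d^{n+1}$ with $\partial_{\mathbf n}d^{n+1}|_{\partial\Omega}=0$, in the variational sense: $q^{n+1}\tilde d^{n+1}\cdot\psi$ is integrable and $(w^{n+1},\psi)=(\nabla d^{n+1},\nabla\psi)+(q^{n+1}\tilde d^{n+1},\psi)$ for all $\psi\in H^1(\Omega)^m$. 3. $\displaystyle \frac{3q^{n+1}-4q^n+q^{n-1}}{2\Delta t}=\frac{2}{\varepsilon^2}\,\tilde d^{n+1}\cdot\frac{3d^{n+1}-4d^n+d^{n-1}}{2\Delta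 t}$ a.e. in $\Omega$. 4. $\displaystyle \frac{3u_*^{n+1}-4u^n+u^{n-1}}{2\Delta t}+K^{n+1}(\tilde u^{n+1}\cdot\nabla)\tilde u^{n+1}-\nu\Delta u_*^{n+1}+\nabla p^n=\lambda K^{n+1}(\nabla\tilde d^{n+1})^t\tilde w^{n+1}$, $u_*^{n+1}|_{\partial\Omega}=0$, in the variational sense, that is, tested with all $v\in H^1_0(\Omega)^m$, with $(-\Delta u_*^{n+1},v)=(\nabla u_*^{n+1},\nabla v)$ and $(\nabla p^n,v)=-(p^n,\nabla\cdot v)$; the products of $(\tilde u^{n+1}\cdot\nabla)\tilde u^{n+1}$ and of $(\nabla\tilde d^{n+1})^t\tilde w^{n+1}$ with such $v$ are integrable. 5. $p^{n+1}-p^n+\nu\nabla\cdot u_*^{n+1}\in H^1(\Omega)$ and $\displaystyle \frac{3u^{n+1}-3u_*^{n+1}}{2\Delta t}+\nabla\big(p^{n+1}-p^n+\nu\nabla\cdot u_*^{n+1}\big)=0$ a.e. in $\Omega$. 6. $((\tilde u^{n+1}\cdot\nabla)\tilde d^{n+1})\cdot w^{n+1}$ is integrable and $$\frac{3s^{n+1}-4s^n+s^{n-1}}{2\Delta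 t}=-\frac{s^{n+1}}{T}+\frac{1}{\exp(-t^{n+1}/T)}\Big[\big((\tilde u^{n+1}\cdot\nabla)\tilde d^{n+1},w^{n+1}\big)-\big((u_*^{n+1}\cdot\nabla)\tilde d^{n+1},\tilde w^{n+1}\big)+\frac1\lambda\big((\tilde u^{n+1}\cdot\nabla)\tilde u^{n+1},u_*^{n+1}\big)\Big].$$ Put $g^0=0$, $g^{n+1}=\nu\nabla\cdot u_*^{n+1}+g^n$, $H^n=p^n+g^n$, and for $n\ge1$ $$\begin{aligned}E^{*,n}={}&\tfrac12\|u^n\|^2+\tfrac12\|2u^n-u^{n-1}\|^2+\tfrac23\Delta t^2\|\nabla H^n\|^2+\nu^{-1}\Delta t\|g^n\|^2+\tfrac\lambda2\|\nabla d^n\|^2+\tfrac\lambda2\|\nabla(2d^n-d^{n-1})\|^2\\&+\tfrac{\lambda\varepsilon^2}4\|q^n\|^2+\tfrac{\lambda\varepsilon^2}4\|2q^n-q^{n-1}\|^2+\tfrac\lambda2|s^n|^2+\tfrac\lambda2|2s^n-s^{n-1}|^2.\end{aligned}$$ **Theorem.** The scheme is unconditionally energy stable: without any restriction on $\Delta t$,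 $H^n\in H^1(\Omega)$ for all $1\le n\le N$, and for all $1\le n<N$ $$E^{*,n+1}+2\Delta t\,\lambda\gamma\|w^{n+1}\|^2+\nu\Delta t\|\nabla u_*^{n+1}\|^2+\nu\Delta t\|\nabla\times u_*^{n+1}\|^2+\lambda\frac{2\Delta t}{T}|s^{n+1}|^2\le E^{*,n}.$$ -/

import Mathlib

open MeasureTheory Filter Topology
open scoped ContDiff

noncomputable section

namespace PCSAV

/-- Points of `ℝ^m`, and values of vector fields, with the Euclidean norm. -/
abbrev E (m : ℕ) : Type := EuclideanSpace ℝ (Fin m)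

variable {m : ℕ}

/-! ### Weak derivatives and Sobolev spaces -/

/-- `φ ∈ C_c^∞(Ω)`. -/
def IsTest (Ω : Set (E m)) (φ : E m → ℝ) : Prop :=
  ContDiff ℝ ∞ φ ∧ HasCompactSupport φ ∧ tsupport φ ⊆ Ω

/-- The classical partial derivative `∂_i φ`. -/
def classicalDeriv (i : Fin m) (φ : E m → ℝ) (x : E m) : ℝ :=
  fderiv ℝ φ x (EuclideanSpace.single i 1)

/-- `g` is a weak partial derivative `∂_i f` on `Ω`; both are locally integrable on `Ω`. -/
def HasWeakDeriv (Ω : Set (E m)) (i : Fin m) (f g : E m → ℝ) : Prop :=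
  LocallyIntegrableOn f Ω ∧ LocallyIntegrableOn g Ω ∧
    ∀ φ, IsTest Ω φ →
      ∫ x in Ω, f x * classicalDeriv i φ x = - ∫ x in Ω, g x * φ x

/-- `f` has all first order weak derivatives on `Ω`, as locally integrable functions. -/
def WeaklyDifferentiable (Ω : Set (E m)) (f : E m → ℝ) : Prop :=
  ∀ i, ∃ g, HasWeakDeriv Ω i f g

open Classical in
/-- The weak partial derivative `∂_i f` on `Ω` (determined almost everywhere on `Ω`);
zero if there is none. -/
def weakDeriv (Ω : Set (E m)) (i : Fin m) (f : E m → ℝ) : E m → ℝ :=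
  if h : ∃ g, HasWeakDeriv Ω i f g then h.choose else 0

/-- `f ∈ H^1(Ω)`. -/
def MemH1 (Ω : Set (E m)) (f : E m → ℝ) : Prop :=
  MemLp f 2 (volume.restrict Ω) ∧ WeaklyDifferentiable Ω f ∧
    ∀ i, MemLp (weakDeriv Ω i f) 2 (volume.restrict Ω)

/-- `f ∈ H^1_0(Ω)`, the closure of `C_c^∞(Ω)` in `H^1(Ω)`. -/
def MemH10 (Ω : Set (E m)) (f : E m → ℝ) : Prop :=
  MemH1 Ω f ∧ ∃ φ : ℕ → E m → ℝ, (∀ k, IsTest Ω (φ k)) ∧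
    Tendsto (fun k => eLpNorm (fun x => f x - φ k x) 2 (volume.restrict Ω)) atTop (𝓝 0) ∧
    ∀ i, Tendsto (fun k => eLpNorm
      (fun x => weakDeriv Ω i f x - classicalDeriv i (φ k) x) 2 (volume.restrict Ω))
      atTop (𝓝 0)

/-- `v ∈ H^1(Ω)^m`. -/
def MemH1V (Ω : Set (E m)) (v : E m → E m) : Prop := ∀ j, MemH1 Ω (fun x => v x j)

/-- `v ∈ H^1_0(Ω)^m`, that is `v ∈ H^1(Ω)^m` and `v = 0` on the boundary. -/
def MemH10V (Ω : Set (E m)) (v : E m → E m) : Prop := ∀ j, MemH10 Ω (fun x => v x j)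

/-! ### Differential operators (in the weak sense) and `L^2` products -/

/-- `∇f`. -/
def grad (Ω : Set (E m)) (f : E m → ℝ) (x : E m) : E m :=
  WithLp.toLp 2 fun i => weakDeriv Ω i f x

/-- The tensor `∇v`, with the entries `∂_i v_j` and the Frobenius norm. -/
def gradV (Ω : Set (E m)) (v : E m → E m) (x : E m) : EuclideanSpace ℝ (Fin m × Fin m) :=
  WithLp.toLp 2 fun ij => weakDeriv Ω ij.1 (fun y => v y ij.2) x

/-- `∇·v`. -/
def divg (Ω : Set (E m)) (v : E m → E m) (x : E m) : ℝ :=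
  ∑ i, weakDeriv Ω i (fun y => v y i) x

/-- `∇×v`, listed by its components `∂_i v_j - ∂_j v_i` for `i < j`: the scalar curl in dimension
two and, up to the order and the signs of the components, the vector curl in dimension three. -/
def curl (Ω : Set (E m)) (v : E m → E m) (x : E m) :
    EuclideanSpace ℝ {ij : Fin m × Fin m // ij.1 < ij.2} :=
  WithLp.toLp 2 fun ij =>
    weakDeriv Ω ij.1.1 (fun y => v y ij.1.2) x - weakDeriv Ω ij.1.2 (fun y => v y ij.1.1) x

/-- `(a·∇)b`, with the components `∑_i a_i ∂_i b_j`. -/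
def conv (Ω : Set (E m)) (a b : E m → E m) (x : E m) : E m :=
  WithLp.toLp 2 fun j => ∑ i, a x i * weakDeriv Ω i (fun y => b y j) x

/-- `(∇d)^t w`, with the components `∑_j (∂_i d_j) w_j`. -/
def gradT (Ω : Set (E m)) (d w : E m → E m) (x : E m) : E m :=
  WithLp.toLp 2 fun i => ∑ j, weakDeriv Ω i (fun y => d y j) x * w x j

/-- The `L^2(Ω)` inner product of scalar, vector or tensor fields. -/
def l2inner {F : Type*} [NormedAddCommGroup F] [InnerProductSpace ℝ F]
    (Ω : Set (E m)) (f g : E m → F) : ℝ :=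
  ∫ x in Ω, inner ℝ (f x) (g x)

/-- The squared `L^2(Ω)` norm of a scalar, vector or tensor field. -/
def l2sq {F : Type*} [NormedAddCommGroup F] (Ω : Set (E m)) (f : E m → F) : ℝ :=
  ∫ x in Ω, ‖f x‖ ^ 2

/-- The product `f·g` is integrable on `Ω`. -/
def Pairs {F : Type*} [NormedAddCommGroup F] [InnerProductSpace ℝ F]
    (Ω : Set (E m)) (f g : E m → F) : Prop :=
  Integrable (fun x => inner ℝ (f x) (g x)) (volume.restrict Ω)

/-- `v·n = 0` on the boundary of `Ω`, where the normal trace of a field with square integrable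
divergence is the functional `ψ ↦ ∫_Ω v·∇ψ + (∇·v) ψ` on `H^1(Ω)`. -/
def ZeroNormalTrace (Ω : Set (E m)) (v : E m → E m) : Prop :=
  ∀ ψ, MemH1 Ω ψ → l2inner Ω v (grad Ω ψ) + l2inner Ω (divg Ω v) ψ = 0

/-! ### The scheme -/

/-- Viscosity `ν`, elasticity constant `λ`, relaxation constant `γ`, penalty parameter `ε`,
final time `T` and number `N` of time steps. -/
structure Params where
  ν : ℝ
  lam : ℝ
  γ : ℝ
  ε : ℝ
  T : ℝ
  N : ℕ
  ν_pos : 0 < ν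
  lam_pos : 0 < lam
  γ_pos : 0 < γ
  ε_pos : 0 < ε
  T_pos : 0 < T
  N_pos : 0 < N

/-- The time step `Δt = T / N`. -/
def Params.dt (P : Params) : ℝ := P.T / P.N

/-- `exp (-t^n / T)` at the time `t^n = n Δt`. -/
def Params.e (P : Params) (n : ℕ) : ℝ := Real.exp (-(n * P.dt) / P.T)

/-- The sequences `u^n`, `u_*^n`, `d^n`, `w^n`, `p^n`, `q^n`, `s^n`. -/
structure Iterates (m : ℕ) where
  u : ℕ → E m → E m
  ustar : ℕ → E m → E m
  d : ℕ → E m → E m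
  w : ℕ → E m → E m
  p : ℕ → E m → ℝ
  q : ℕ → E m → ℝ
  s : ℕ → ℝ

/-- The extrapolation `2 f^n - f^{n-1}`, which approximates `f` at the level `n + 1`. -/
def extrap {V : Type*} [AddCommGroup V] [Module ℝ V] (f : ℕ → V) (n : ℕ) : V :=
  (2 : ℝ) • f n - f (n - 1)

/-- `3 f^{n+1} - 4 f^n + f^{n-1}`. -/
def bdf {V : Type*} [AddCommGroup V] [Module ℝ V] (f : ℕ → V) (n : ℕ) : V :=
  (3 : ℝ) • f (n + 1) - (4 : ℝ) • f n + f (n - 1)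

/-- `3 u_*^{n+1} - 4 u^n + u^{n-1}`. -/
def bdfStar (I : Iterates m) (n : ℕ) : E m → E m :=
  (3 : ℝ) • I.ustar (n + 1) - (4 : ℝ) • I.u n + I.u (n - 1)

/-- The SAV factor `s^{n+1} / exp (-t^{n+1} / T)`. -/
def savFactor (P : Params) (I : Iterates m) (n : ℕ) : ℝ := I.s (n + 1) / P.e (n + 1)

/-- `p^{n+1} - p^n + ν ∇·u_*^{n+1}`. -/
def pressureIncr (Ω : Set (E m)) (P : Params) (I : Iterates m) (n : ℕ) : E m → ℝ :=
  fun x => I.p (n + 1) x - I.p n x + P.ν * divg Ω (I.ustar (n + 1)) x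

/-- One step, from the levels `n - 1, n` to the level `n + 1`, of the PCSAV-ECT scheme. -/
structure IsStep (Ω : Set (E m)) (P : Params) (I : Iterates m) (n : ℕ) : Prop where
  /-- The equation for `d^{n+1}`. -/
  director : ∀ᵐ x ∂(volume.restrict Ω),
    (1 / (2 * P.dt)) • bdf I.d n x
      + savFactor P I n • conv Ω (extrap I.u n) (extrap I.d n) x
      + P.γ • I.w (n + 1) x = 0
  /-- `w^{n+1} = -Δd^{n+1} + q^{n+1} d̃^{n+1}` with the boundary condition `∂_n d^{n+1} = 0`,
  in the variational form, whose test functions run through `H^1(Ω)^m`. -/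
  chemical : ∀ ψ, MemH1V Ω ψ →
    Pairs Ω (fun x => I.q (n + 1) x • extrap I.d n x) ψ ∧
    l2inner Ω (I.w (n + 1)) ψ
      = l2inner Ω (gradV Ω (I.d (n + 1))) (gradV Ω ψ)
        + l2inner Ω (fun x => I.q (n + 1) x • extrap I.d n x) ψ
  /-- The equation for `q^{n+1}`. -/
  multiplier : ∀ᵐ x ∂(volume.restrict Ω),
    bdf I.q n x / (2 * P.dt)
      = 2 / P.ε ^ 2 * inner ℝ (extrap I.d n x) ((1 / (2 * P.dt)) • bdf I.d n x)
  /-- The equation for `u_*^{n+1}` with explicit convection, in the variational form, whose test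
  functions run through `H^1_0(Ω)^m`. -/
  momentum : ∀ v, MemH10V Ω v →
    Pairs Ω (conv Ω (extrap I.u n) (extrap I.u n)) v ∧
    Pairs Ω (gradT Ω (extrap I.d n) (extrap I.w n)) v ∧
    1 / (2 * P.dt) * l2inner Ω (bdfStar I n) v
      + savFactor P I n * l2inner Ω (conv Ω (extrap I.u n) (extrap I.u n)) v
      + P.ν * l2inner Ω (gradV Ω (I.ustar (n + 1))) (gradV Ω v)
      - l2inner Ω (I.p n) (divg Ω v)
      = P.lam * savFactor P I n * l2inner Ω (gradT Ω (extrap I.d n) (extrap I.w n)) v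
  /-- The pressure correction. -/
  incr_mem : MemH1 Ω (pressureIncr Ω P I n)
  correction : ∀ᵐ x ∂(volume.restrict Ω),
    (1 / (2 * P.dt)) • ((3 : ℝ) • I.u (n + 1) x - (3 : ℝ) • I.ustar (n + 1) x)
      + grad Ω (pressureIncr Ω P I n) x = 0
  /-- The equation for `s^{n+1}`. -/
  sav_pairs : Pairs Ω (conv Ω (extrap I.u n) (extrap I.d n)) (I.w (n + 1))
  sav : (3 * I.s (n + 1) - 4 * I.s n + I.s (n - 1)) / (2 * P.dt)
    = - (I.s (n + 1) / P.T)
      + 1 / P.e (n + 1)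
        * l2inner Ω (conv Ω (extrap I.u n) (extrap I.d n)) (I.w (n + 1))
      - 1 / P.e (n + 1)
        * l2inner Ω (conv Ω (I.ustar (n + 1)) (extrap I.d n)) (extrap I.w n)
      + 1 / P.lam * (1 / P.e (n + 1))
        * l2inner Ω (conv Ω (extrap I.u n) (extrap I.u n)) (I.ustar (n + 1))

/-- `g^0 = 0`, `g^{n+1} = ν ∇·u_*^{n+1} + g^n`. -/
def gSeq (Ω : Set (E m)) (P : Params) (I : Iterates m) : ℕ → E m → ℝ
  | 0 => 0
  | n + 1 => fun x => P.ν * divg Ω (I.ustar (n + 1)) x + gSeq Ω P I n x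

/-- `H^n = p^n + g^n`. -/
def hSeq (Ω : Set (E m)) (P : Params) (I : Iterates m) (n : ℕ) : E m → ℝ :=
  fun x => I.p n x + gSeq Ω P I n x

/-- The sequences form a solution of the PCSAV-ECT scheme on the time levels `0, …, N`, with
arbitrary admissible starting values at the levels `0` and `1` (for `u_*` at the level `1`, where
for instance `u_*^1 = u^1` may be taken). -/
structure IsSolution (Ω : Set (E m)) (P : Params) (I : Iterates m) : Prop where
  u_mem : ∀ n ≤ P.N, MemLp (I.u n) 2 (volume.restrict Ω)
  u_diff : ∀ n ≤ P.N, ∀ j, WeaklyDifferentiable Ω (fun x => I.u n x j)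
  u_divFree : ∀ n ≤ P.N, ∀ᵐ x ∂(volume.restrict Ω), divg Ω (I.u n) x = 0
  u_normal : ∀ n ≤ P.N, ZeroNormalTrace Ω (I.u n)
  ustar_mem : ∀ n, 1 ≤ n → n ≤ P.N → MemH10V Ω (I.ustar n)
  d_mem : ∀ n ≤ P.N, MemH1V Ω (I.d n)
  w_mem : ∀ n ≤ P.N, MemLp (I.w n) 2 (volume.restrict Ω)
  p_mem : ∀ n ≤ P.N, MemLp (I.p n) 2 (volume.restrict Ω)
  q_mem : ∀ n ≤ P.N, MemLp (I.q n) 2 (volume.restrict Ω)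
  start_mem : MemH1 Ω (hSeq Ω P I 1)
  step : ∀ n, 1 ≤ n → n < P.N → IsStep Ω P I n

/-- The modified energy `E^*` at the level `n ≥ 1`. -/
def energy (Ω : Set (E m)) (P : Params) (I : Iterates m) (n : ℕ) : ℝ :=
  1 / 2 * l2sq Ω (I.u n) + 1 / 2 * l2sq Ω (extrap I.u n)
    + 2 / 3 * P.dt ^ 2 * l2sq Ω (grad Ω (hSeq Ω P I n))
    + P.ν⁻¹ * P.dt * l2sq Ω (gSeq Ω P I n)
    + P.lam / 2 * l2sq Ω (gradV Ω (I.d n)) + P.lam / 2 * l2sq Ω (gradV Ω (extrap I.d n))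
    + P.lam * P.ε ^ 2 / 4 * l2sq Ω (I.q n) + P.lam * P.ε ^ 2 / 4 * l2sq Ω (extrap I.q n)
    + P.lam / 2 * |I.s n| ^ 2 + P.lam / 2 * |extrap I.s n| ^ 2

end PCSAV

end

open PCSAV

namespace PCSAV

variable {m : ℕ} {Ω : Set (E m)}

/-! ### Test functions and weak derivatives -/

/-! Write τ = Δt and Φ = H^{n+1} - H^n, which is exactly the pressure increment. Test the momentum
equation with u_*^{n+1}, the director equation with w^{n+1}, the equation for w^{n+1} with 3d^{n+1}
- 4d^n + d^{n-1}, and multiply the scalar equation by s^{n+1}. The scalar equation is built so that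
all explicit nonlinear terms then cancel (`energy_balance`), whatever their size; hence no
restriction on τ.

The pressure is handled by u_*^{n+1} = u^{n+1} + (2τ/3)∇Φ, where u^{n+1} is orthogonal to gradients,
and by p^n = H^n - g^n. The H part yields (∇H^n, ∇Φ), which telescopes up to a multiple of ‖∇Φ‖²
that the projection step compensates (`IsSolution.l2inner_bdfStar`, `IsSolution.l2inner_pressure`).
The g part telescopes at the price of ντ‖∇·u_*‖², paid by the viscosity through ‖∇v‖² = ‖∇×v‖² +
‖∇·v‖² on H^1_0 (`MemH10V.l2sq_gradV`). The differences in time are bounded below by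
`le_two_mul_l2inner_bdf`. -/

theorem IsTest.classicalDeriv {φ : E m → ℝ} (h : IsTest Ω φ) (i : Fin m) :
    IsTest Ω (classicalDeriv i φ) := by
  refine ⟨?_, h.2.1.fderiv_apply (𝕜 := ℝ) _, (tsupport_fderiv_apply_subset ℝ _).trans h.2.2⟩
  exact (h.1.fderiv_right (m := ∞) (by simp)).clm_apply contDiff_const

theorem IsTest.classicalDeriv_comm {φ : E m → ℝ} (h : IsTest Ω φ) (i j : Fin m) :
    PCSAV.classicalDeriv i (PCSAV.classicalDeriv j φ)
      = PCSAV.classicalDeriv j (PCSAV.classicalDeriv i φ) := by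
  have hd : Differentiable ℝ (fderiv ℝ φ) :=
    (h.1.fderiv_right (m := 1) (by norm_cast)).differentiable one_ne_zero
  have key : ∀ (i j : Fin m) (x : E m),
      PCSAV.classicalDeriv i (PCSAV.classicalDeriv j φ) x
        = fderiv ℝ (fderiv ℝ φ) x (EuclideanSpace.single i 1) (EuclideanSpace.single j 1) := by
    intro i j x
    have := ((hd x).hasFDerivAt.clm_apply
      (hasFDerivAt_const (EuclideanSpace.single j (1 : ℝ)) x)).fderiv
    unfold PCSAV.classicalDeriv
    rw [this]
    simp
  funext x
  rw [key, key]
  exact (h.1.contDiffAt.isSymmSndFDerivAt (by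
    rw [minSmoothness_of_isRCLikeNormedField]
    exact WithTop.coe_le_coe.2 (le_top : (2 : ℕ∞) ≤ ⊤))).eq _ _

theorem IsTest.memLp {φ : E m → ℝ} (h : IsTest Ω φ) :
    MemLp φ 2 (volume.restrict Ω) :=
  (h.1.continuous.memLp_of_hasCompactSupport h.2.1).restrict Ω

theorem IsTest.integrableOn_mul {φ f : E m → ℝ} (h : IsTest Ω φ) (hf : LocallyIntegrableOn f Ω) :
    IntegrableOn (fun x => f x * φ x) Ω := by
  have h1 : IntegrableOn (fun x => f x * φ x) (tsupport φ) :=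
    (hf.integrableOn_compact_subset h.2.2 h.2.1).mul_continuousOn h.1.continuous.continuousOn h.2.1
  have h2 : Integrable (fun x => f x * φ x) := by
    refine (integrableOn_iff_integrable_of_support_subset fun x hx => ?_).1 h1
    refine subset_tsupport _ ?_
    simp only [Function.mem_support, ne_eq, mul_eq_zero, not_or] at hx ⊢
    exact hx.2
  exact h2.integrableOn

/-- The fundamental lemma of the calculus of variations. Since `weakDeriv` is an arbitrary choice,
this uniqueness is the source of its linearity, which holds only almost everywhere. -/
theorem HasWeakDeriv.ae_eq (hΩ : IsOpen Ω) {i : Fin m} {f g g' : E m → ℝ}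
    (h : HasWeakDeriv Ω i f g) (h' : HasWeakDeriv Ω i f g') : g =ᵐ[volume.restrict Ω] g' := by
  have key : ∀ᵐ x, x ∈ Ω → (g - g') x = 0 := by
    refine hΩ.ae_eq_zero_of_integral_contDiff_smul_eq_zero (h.2.1.sub h'.2.1) ?_
    intro φ h1 h2 h3
    have hφ : IsTest Ω φ := ⟨h1, h2, h3⟩
    have e1 : ∫ x, φ x • (g - g') x = ∫ x in Ω, φ x • (g - g') x := by
      refine (setIntegral_eq_integral_of_forall_compl_eq_zero fun x hx => ?_).symm
      rw [image_eq_zero_of_notMem_tsupport fun hx' => hx (h3 hx'), zero_smul]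
    have e2 : ∫ x in Ω, φ x • (g - g') x = (∫ x in Ω, g x * φ x) - ∫ x in Ω, g' x * φ x := by
      rw [← integral_sub (hφ.integrableOn_mul h.2.1) (hφ.integrableOn_mul h'.2.1)]
      congr 1
      funext x
      simp only [Pi.sub_apply, smul_eq_mul]
      ring
    have a := h.2.2 φ hφ
    have b := h'.2.2 φ hφ
    rw [e1, e2]
    linarith
  rw [EventuallyEq, ae_restrict_iff' hΩ.measurableSet]
  filter_upwards [key] with x hx hxΩ
  exact sub_eq_zero.1 (hx hxΩ)

theorem LocallyIntegrableOn.const_mul {f : E m → ℝ} (h : LocallyIntegrableOn f Ω) (a : ℝ) :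
    LocallyIntegrableOn (fun x => a * f x) Ω := fun x hx =>
  let ⟨t, ht, h⟩ := h x hx
  ⟨t, ht, h.const_mul a⟩

theorem HasWeakDeriv.linearComb {i : Fin m} {f g f' g' : E m → ℝ} (a b : ℝ)
    (h : HasWeakDeriv Ω i f f') (h' : HasWeakDeriv Ω i g g') :
    HasWeakDeriv Ω i (fun x => a * f x + b * g x) (fun x => a * f' x + b * g' x) := by
  refine ⟨(LocallyIntegrableOn.const_mul h.1 a).add (LocallyIntegrableOn.const_mul h'.1 b),
    (LocallyIntegrableOn.const_mul h.2.1 a).add (LocallyIntegrableOn.const_mul h'.2.1 b), ?_⟩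
  intro φ hφ
  have comb : ∀ (f g ψ : E m → ℝ), LocallyIntegrableOn f Ω → LocallyIntegrableOn g Ω →
      IsTest Ω ψ → ∫ x in Ω, (a * f x + b * g x) * ψ x
        = a * (∫ x in Ω, f x * ψ x) + b * ∫ x in Ω, g x * ψ x := by
    intro f g ψ hf hg hψ
    rw [← integral_const_mul, ← integral_const_mul,
      ← integral_add ((hψ.integrableOn_mul hf).const_mul a) ((hψ.integrableOn_mul hg).const_mul b)]
    congr 1
    funext x
    ring
  rw [comb f g _ h.1 h'.1 (hφ.classicalDeriv i), comb f' g' _ h.2.1 h'.2.1 hφ,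
    h.2.2 φ hφ, h'.2.2 φ hφ]
  ring

theorem WeaklyDifferentiable.hasWeakDeriv {f : E m → ℝ} (h : WeaklyDifferentiable Ω f)
    (i : Fin m) : HasWeakDeriv Ω i f (weakDeriv Ω i f) := by
  rw [weakDeriv, dif_pos (h i)]
  exact (h i).choose_spec

theorem MemH1.hasWeakDeriv {f : E m → ℝ} (h : MemH1 Ω f) (i : Fin m) :
    HasWeakDeriv Ω i f (weakDeriv Ω i f) :=
  h.2.1.hasWeakDeriv i

theorem MemH1.weakDeriv_linearComb (hΩ : IsOpen Ω) {f g : E m → ℝ} (a b : ℝ) (hf : MemH1 Ω f)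
    (hg : MemH1 Ω g) (i : Fin m) :
    weakDeriv Ω i (fun x => a * f x + b * g x) =ᵐ[volume.restrict Ω]
      fun x => a * weakDeriv Ω i f x + b * weakDeriv Ω i g x :=
  have hd : WeaklyDifferentiable Ω (fun x => a * f x + b * g x) := fun i =>
    ⟨_, (hf.hasWeakDeriv i).linearComb a b (hg.hasWeakDeriv i)⟩
  (hd.hasWeakDeriv i).ae_eq hΩ ((hf.hasWeakDeriv i).linearComb a b (hg.hasWeakDeriv i))

theorem MemH1.linearComb (hΩ : IsOpen Ω) {f g : E m → ℝ} (a b : ℝ) (hf : MemH1 Ω f)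
    (hg : MemH1 Ω g) : MemH1 Ω (fun x => a * f x + b * g x) :=
  ⟨(hf.1.const_mul a).add (hg.1.const_mul b),
    fun i => ⟨_, (hf.hasWeakDeriv i).linearComb a b (hg.hasWeakDeriv i)⟩,
    fun i => (memLp_congr_ae (hf.weakDeriv_linearComb hΩ a b hg i)).2
      (((hf.2.2 i).const_mul a).add ((hg.2.2 i).const_mul b))⟩

theorem MemH1V.linearComb (hΩ : IsOpen Ω) {f g : E m → E m} (a b : ℝ) (hf : MemH1V Ω f)
    (hg : MemH1V Ω g) : MemH1V Ω (a • f + b • g) := fun j =>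
  (hf j).linearComb hΩ a b (hg j)

theorem MemH1.grad_linearComb (hΩ : IsOpen Ω) {f g : E m → ℝ} (a b : ℝ) (hf : MemH1 Ω f)
    (hg : MemH1 Ω g) : grad Ω (fun x => a * f x + b * g x) =ᵐ[volume.restrict Ω]
      a • grad Ω f + b • grad Ω g := by
  filter_upwards [ae_all_iff.2 (hf.weakDeriv_linearComb hΩ a b hg)] with x hx
  ext i
  simp [grad, hx]

theorem MemH1V.gradV_linearComb (hΩ : IsOpen Ω) {f g : E m → E m} (a b : ℝ) (hf : MemH1V Ω f)
    (hg : MemH1V Ω g) : gradV Ω (a • f + b • g) =ᵐ[volume.restrict Ω]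
      a • gradV Ω f + b • gradV Ω g := by
  have h : ∀ᵐ x ∂(volume.restrict Ω), ∀ ij : Fin m × Fin m,
      weakDeriv Ω ij.1 (fun y => a * f y ij.2 + b * g y ij.2) x
        = a * weakDeriv Ω ij.1 (fun y => f y ij.2) x
          + b * weakDeriv Ω ij.1 (fun y => g y ij.2) x :=
    ae_all_iff.2 fun ij => (hf ij.2).weakDeriv_linearComb hΩ a b (hg ij.2) ij.1
  filter_upwards [h] with x hx
  ext ij
  simpa [gradV] using hx ij

theorem MemH1V.memLp {v : E m → E m} (h : MemH1V Ω v) : MemLp v 2 (volume.restrict Ω) :=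
  MemLp.of_eval_piLp fun j => (h j).1

theorem MemH10V.memH1V {v : E m → E m} (h : MemH10V Ω v) : MemH1V Ω v := fun j => (h j).1

theorem MemH1.memLp_grad {f : E m → ℝ} (h : MemH1 Ω f) :
    MemLp (grad Ω f) 2 (volume.restrict Ω) :=
  MemLp.of_eval_piLp fun i => h.2.2 i

theorem MemH1V.memLp_gradV {v : E m → E m} (h : MemH1V Ω v) :
    MemLp (gradV Ω v) 2 (volume.restrict Ω) :=
  MemLp.of_eval_piLp fun ij => (h ij.2).2.2 ij.1

theorem MemH1V.memLp_divg {v : E m → E m} (h : MemH1V Ω v) :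
    MemLp (divg Ω v) 2 (volume.restrict Ω) :=
  memLp_finsetSum _ fun i _ => (h i).2.2 i

/-! ### Integration by parts in `H^1_0` -/

/-- Continuity of the inner product of L²; it carries identities from test functions to H^1_0. -/
theorem tendsto_integral_mul_of_tendsto_eLpNorm {α : Type*} [MeasurableSpace α] {μ : Measure α}
    {f g : α → ℝ} {G : ℕ → α → ℝ} (hf : MemLp f 2 μ) (hg : MemLp g 2 μ)
    (hG : ∀ k, MemLp (G k) 2 μ)
    (h : Tendsto (fun k => eLpNorm (fun x => g x - G k x) 2 μ) atTop (𝓝 0)) :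
    Tendsto (fun k => ∫ x, f x * G k x ∂μ) atTop (𝓝 (∫ x, f x * g x ∂μ)) := by
  have conv : Tendsto (fun k => (hG k).toLp (G k)) atTop (𝓝 (hg.toLp g)) := by
    rw [Lp.tendsto_Lp_iff_tendsto_eLpNorm'' _ hG]
    refine h.congr fun k => ?_
    rw [← eLpNorm_neg]
    congr 1
    funext x
    simp
  have inner_eq : ∀ {φ : α → ℝ} (hφ : MemLp φ 2 μ),
      inner ℝ (hf.toLp f) (hφ.toLp φ) = ∫ x, f x * φ x ∂μ := by
    intro φ hφ
    rw [L2.inner_def]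
    refine integral_congr_ae ?_
    filter_upwards [hf.coeFn_toLp, hφ.coeFn_toLp] with x h1 h2
    rw [h1, h2]
    simp [mul_comm]
  rw [← inner_eq hg]
  simp_rw [← inner_eq (hG _)]
  exact tendsto_const_nhds.inner conv

theorem MemH10.integral_mul_weakDeriv {f v : E m → ℝ} (hf : MemH1 Ω f) (hv : MemH10 Ω v)
    (i : Fin m) :
    ∫ x in Ω, f x * weakDeriv Ω i v x = - ∫ x in Ω, weakDeriv Ω i f x * v x := by
  obtain ⟨hv1, φ, hφ, h0, h1⟩ := hv
  have l1 := tendsto_integral_mul_of_tendsto_eLpNorm hf.1 (hv1.2.2 i)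
    (fun k => ((hφ k).classicalDeriv i).memLp) (h1 i)
  have l2 := tendsto_integral_mul_of_tendsto_eLpNorm (hf.2.2 i) hv1.1
    (fun k => (hφ k).memLp) h0
  refine tendsto_nhds_unique l1 (l2.neg.congr fun k => ?_)
  rw [(hf.hasWeakDeriv i).2.2 _ (hφ k)]

/-- For a test function φ in place of v, both sides equal -∫ f ∂_i∂_jφ. Only φ is differentiated
twice, so H^1 regularity of f suffices; density gives the rest. -/
theorem MemH10.integral_weakDeriv_mul_weakDeriv_comm {f v : E m → ℝ} (hf : MemH1 Ω f)
    (hv : MemH10 Ω v) (i j : Fin m) :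
    ∫ x in Ω, weakDeriv Ω i f x * weakDeriv Ω j v x
      = ∫ x in Ω, weakDeriv Ω j f x * weakDeriv Ω i v x := by
  obtain ⟨hv1, φ, hφ, h0, h1⟩ := hv
  have l1 := tendsto_integral_mul_of_tendsto_eLpNorm (hf.2.2 i) (hv1.2.2 j)
    (fun k => ((hφ k).classicalDeriv j).memLp) (h1 j)
  have l2 := tendsto_integral_mul_of_tendsto_eLpNorm (hf.2.2 j) (hv1.2.2 i)
    (fun k => ((hφ k).classicalDeriv i).memLp) (h1 i)
  refine tendsto_nhds_unique l1 (l2.congr fun k => ?_)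
  have e1 := (hf.hasWeakDeriv i).2.2 _ ((hφ k).classicalDeriv j)
  have e2 := (hf.hasWeakDeriv j).2.2 _ ((hφ k).classicalDeriv i)
  rw [(hφ k).classicalDeriv_comm i j] at e1
  linarith

end PCSAV

namespace PCSAV

variable {m : ℕ} {Ω : Set (E m)}

/-! ### `L^2` products -/

section L2

variable {F : Type*} [NormedAddCommGroup F] [InnerProductSpace ℝ F]

theorem pairs_of_memLp {f g : E m → F} (hf : MemLp f 2 (volume.restrict Ω))
    (hg : MemLp g 2 (volume.restrict Ω)) : Pairs Ω f g := by
  refine ((L2.integrable_inner (𝕜 := ℝ) (hf.toLp f) (hg.toLp g)).congr ?_)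
  filter_upwards [hf.coeFn_toLp, hg.coeFn_toLp] with x h1 h2
  rw [h1, h2]

theorem integrable_norm_sq {f : E m → F} (hf : MemLp f 2 (volume.restrict Ω)) :
    Integrable (fun x => ‖f x‖ ^ 2) (volume.restrict Ω) := by
  simpa [Pairs] using pairs_of_memLp hf hf

theorem l2inner_self (f : E m → F) : l2inner Ω f f = l2sq Ω f := by
  simp [l2inner, l2sq]

theorem l2sq_nonneg {F : Type*} [NormedAddCommGroup F] (f : E m → F) : 0 ≤ l2sq Ω f :=
  integral_nonneg fun _ => by positivity

theorem l2inner_comm (f g : E m → F) : l2inner Ω f g = l2inner Ω g f := by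
  simp only [l2inner, real_inner_comm]

theorem l2inner_congr {f f' g g' : E m → F} (hf : f =ᵐ[volume.restrict Ω] f')
    (hg : g =ᵐ[volume.restrict Ω] g') : l2inner Ω f g = l2inner Ω f' g' := by
  refine integral_congr_ae ?_
  filter_upwards [hf, hg] with x h1 h2
  rw [h1, h2]

theorem l2sq_congr {f f' : E m → F} (hf : f =ᵐ[volume.restrict Ω] f') :
    l2sq Ω f = l2sq Ω f' := by
  rw [← l2inner_self, ← l2inner_self, l2inner_congr hf hf]

theorem l2inner_linearComb_left {f g h : E m → F} (a b : ℝ) (hf : Pairs Ω f h)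
    (hg : Pairs Ω g h) :
    l2inner Ω (a • f + b • g) h = a * l2inner Ω f h + b * l2inner Ω g h := by
  unfold l2inner
  rw [← integral_const_mul, ← integral_const_mul,
    ← integral_add (hf.const_mul a) (hg.const_mul b)]
  congr 1
  funext x
  simp [inner_add_left, real_inner_smul_left]

theorem l2inner_linearComb_right {f g h : E m → F} (a b : ℝ) (hf : Pairs Ω h f)
    (hg : Pairs Ω h g) :
    l2inner Ω h (a • f + b • g) = a * l2inner Ω h f + b * l2inner Ω h g := by
  have hf' : Pairs Ω f h := by simpa only [Pairs, real_inner_comm] using hf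
  have hg' : Pairs Ω g h := by simpa only [Pairs, real_inner_comm] using hg
  rw [l2inner_comm, l2inner_linearComb_left a b hf' hg', l2inner_comm f, l2inner_comm g]

theorem l2sq_linearComb {f g : E m → F} (a b : ℝ) (hf : MemLp f 2 (volume.restrict Ω))
    (hg : MemLp g 2 (volume.restrict Ω)) :
    l2sq Ω (a • f + b • g) = a ^ 2 * l2sq Ω f + 2 * a * b * l2inner Ω f g + b ^ 2 * l2sq Ω g := by
  have hs := (hf.const_smul a).add (hg.const_smul b)
  rw [← l2inner_self, l2inner_linearComb_left a b (pairs_of_memLp hf hs) (pairs_of_memLp hg hs),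
    l2inner_linearComb_right a b (pairs_of_memLp hf hf) (pairs_of_memLp hf hg),
    l2inner_linearComb_right a b (pairs_of_memLp hg hf) (pairs_of_memLp hg hg),
    l2inner_self, l2inner_self, l2inner_comm g f]
  ring

theorem memLp_bdf {f : ℕ → E m → F} {n : ℕ} (h2 : MemLp (f (n + 1)) 2 (volume.restrict Ω))
    (h1 : MemLp (f n) 2 (volume.restrict Ω)) (h0 : MemLp (f (n - 1)) 2 (volume.restrict Ω)) :
    MemLp (bdf f n) 2 (volume.restrict Ω) :=
  ((h2.const_smul (3 : ℝ)).sub (h1.const_smul (4 : ℝ))).add h0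

theorem memLp_extrap {f : ℕ → E m → F} {n : ℕ} (h1 : MemLp (f n) 2 (volume.restrict Ω))
    (h0 : MemLp (f (n - 1)) 2 (volume.restrict Ω)) :
    MemLp (extrap f n) 2 (volume.restrict Ω) :=
  (h1.const_smul (2 : ℝ)).sub h0

/-- The last square is the numerical dissipation of the difference formula; dropping it gives the
stability inequality. -/
theorem norm_sq_bdf_identity (a b c : F) :
    2 * inner ℝ ((3 : ℝ) • a - (4 : ℝ) • b + c) a
      = ‖a‖ ^ 2 + ‖(2 : ℝ) • a - b‖ ^ 2 - ‖b‖ ^ 2 - ‖(2 : ℝ) • b - c‖ ^ 2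
        + ‖a - (2 : ℝ) • b + c‖ ^ 2 := by
  simp only [← real_inner_self_eq_norm_sq, inner_add_left, inner_add_right, inner_sub_left,
    inner_sub_right, real_inner_smul_left, real_inner_smul_right, real_inner_comm a b,
    real_inner_comm a c, real_inner_comm b c]
  ring

/-- The `G`-stability of the second order backward difference formula. -/
theorem le_two_mul_l2inner_bdf {f : ℕ → E m → F} {n : ℕ}
    (h2 : MemLp (f (n + 1)) 2 (volume.restrict Ω))
    (h1 : MemLp (f n) 2 (volume.restrict Ω)) (h0 : MemLp (f (n - 1)) 2 (volume.restrict Ω)) :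
    l2sq Ω (f (n + 1)) + l2sq Ω (extrap f (n + 1)) - l2sq Ω (f n) - l2sq Ω (extrap f n)
      ≤ 2 * l2inner Ω (bdf f n) (f (n + 1)) := by
  have i1 := integrable_norm_sq h2
  have i2 := integrable_norm_sq (memLp_extrap (f := f) (n := n + 1) h2 h1)
  have i3 := integrable_norm_sq h1
  have i4 := integrable_norm_sq (memLp_extrap h1 h0)
  have i12 : Integrable (fun x => ‖f (n + 1) x‖ ^ 2 + ‖extrap f (n + 1) x‖ ^ 2)
    (volume.restrict Ω) := i1.add i2
  have i123 : Integrable (fun x => ‖f (n + 1) x‖ ^ 2 + ‖extrap f (n + 1) x‖ ^ 2 - ‖f n x‖ ^ 2)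
    (volume.restrict Ω) := i12.sub i3
  unfold l2sq l2inner
  rw [← integral_add i1 i2, ← integral_sub i12 i3, ← integral_sub i123 i4, ← integral_const_mul]
  refine integral_mono (i123.sub i4)
    ((pairs_of_memLp (memLp_bdf h2 h1 h0) h2).const_mul 2) fun x => ?_
  have := norm_sq_bdf_identity (f (n + 1) x) (f n x) (f (n - 1) x)
  have pos : 0 ≤ ‖f (n + 1) x - (2 : ℝ) • f n x + f (n - 1) x‖ ^ 2 := by positivity
  simp only [Pi.add_apply, Pi.sub_apply, Pi.smul_apply, bdf, extrap, Nat.add_sub_cancel]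
  linarith

end L2

/-! ### Integral identities for vector fields -/

theorem MemH10V.l2inner_divg {f : E m → ℝ} {v : E m → E m} (hf : MemH1 Ω f)
    (hv : MemH10V Ω v) : l2inner Ω f (divg Ω v) = - l2inner Ω (grad Ω f) v := by
  have e1 : l2inner Ω f (divg Ω v) = ∑ i, ∫ x in Ω, f x * weakDeriv Ω i (fun y => v y i) x := by
    have h : ∀ i, Integrable (fun x => f x * weakDeriv Ω i (fun y => v y i) x)
      (volume.restrict Ω) := fun i => hf.1.integrable_mul ((hv i).1.2.2 i)
    rw [← integral_finsetSum _ fun i _ => h i]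
    simp only [l2inner, divg, RCLike.inner_apply, conj_trivial, Finset.mul_sum, mul_comm]
  have e2 : l2inner Ω (grad Ω f) v = ∑ i, ∫ x in Ω, weakDeriv Ω i f x * v x i := by
    have h : ∀ i, Integrable (fun x => weakDeriv Ω i f x * v x i)
      (volume.restrict Ω) := fun i => (hf.2.2 i).integrable_mul (hv i).1.1
    rw [← integral_finsetSum _ fun i _ => h i]
    simp [l2inner, grad, PiLp.inner_apply, mul_comm]
  rw [e1, e2, ← Finset.sum_neg_distrib]
  exact Finset.sum_congr rfl fun i _ => (hv i).integral_mul_weakDeriv hf i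

/-- The sum of (A i j - A j i)² over all i, j is evaluated twice: it counts each pair i < j two
times, and it can be expanded. -/
theorem sum_sq_eq_sum_lt_sub_sq_add {ι : Type*} [Fintype ι] [LinearOrder ι] (A : ι → ι → ℝ) :
    ∑ ij : ι × ι, A ij.1 ij.2 ^ 2
      = ∑ ij : {ij : ι × ι // ij.1 < ij.2}, (A ij.1.1 ij.1.2 - A ij.1.2 ij.1.1) ^ 2
        + ∑ i, ∑ j, A i j * A j i := by
  have h1 : ∑ ij : {ij : ι × ι // ij.1 < ij.2}, (A ij.1.1 ij.1.2 - A ij.1.2 ij.1.1) ^ 2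
      = ∑ i, ∑ j, if i < j then (A i j - A j i) ^ 2 else 0 := by
    rw [← Fintype.sum_prod_type'
      (f := fun i j => if i < j then (A i j - A j i) ^ 2 else (0 : ℝ)), ← Finset.sum_filter]
    exact (Finset.sum_subtype _ (fun x => by simp)
      (fun ij : ι × ι => (A ij.1 ij.2 - A ij.2 ij.1) ^ 2)).symm
  have h2 : ∑ i, ∑ j, (A i j - A j i) ^ 2
      = 2 * ∑ i, ∑ j, if i < j then (A i j - A j i) ^ 2 else 0 := by
    have e : ∀ i j, (A i j - A j i) ^ 2 = (if i < j then (A i j - A j i) ^ 2 else 0)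
        + if j < i then (A j i - A i j) ^ 2 else 0 := by
      intro i j
      rcases lt_trichotomy i j with h | rfl | h
      · simp [h, h.not_gt]
      · simp
      · simp only [h, h.not_gt, if_true, if_false]
        ring
    rw [Finset.sum_congr rfl fun i _ => Finset.sum_congr rfl fun j _ => e i j]
    simp only [Finset.sum_add_distrib]
    rw [Finset.sum_comm (f := fun i j => if j < i then (A j i - A i j) ^ 2 else (0 : ℝ))]
    ring
  have h3 : ∑ i, ∑ j, (A i j - A j i) ^ 2
      = 2 * ∑ i, ∑ j, A i j ^ 2 - 2 * ∑ i, ∑ j, A i j * A j i := by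
    have e : ∀ i j, (A i j - A j i) ^ 2 = A i j ^ 2 + A j i ^ 2 - 2 * (A i j * A j i) :=
      fun i j => by ring
    simp only [e, Finset.sum_sub_distrib, Finset.sum_add_distrib, ← Finset.mul_sum]
    rw [Finset.sum_comm (f := fun i j => A j i ^ 2)]
    ring
  rw [Fintype.sum_prod_type, h1]
  linarith

/-- `‖∇v‖² = ‖∇×v‖² + ‖∇·v‖²` on `H^1_0`. -/
theorem MemH10V.l2sq_gradV {v : E m → E m} (hv : MemH10V Ω v) :
    l2sq Ω (gradV Ω v) = l2sq Ω (curl Ω v) + l2sq Ω (divg Ω v) := by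
  have hp : ∀ i j k l, Integrable (fun x => weakDeriv Ω i (fun y => v y j) x
      * weakDeriv Ω k (fun y => v y l) x) (volume.restrict Ω) := fun i j k l =>
    ((hv j).1.2.2 i).integrable_mul ((hv l).1.2.2 k)
  have hcurl : MemLp (curl Ω v) 2 (volume.restrict Ω) := MemLp.of_eval_piLp fun ij =>
    ((hv ij.1.2).1.2.2 ij.1.1).sub ((hv ij.1.1).1.2.2 ij.1.2)
  have e1 : l2sq Ω (gradV Ω v) = l2sq Ω (curl Ω v)
      + ∫ x in Ω, ∑ i, ∑ j, weakDeriv Ω i (fun y => v y j) x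
        * weakDeriv Ω j (fun y => v y i) x := by
    unfold l2sq
    rw [← integral_add (integrable_norm_sq hcurl)
      (integrable_finsetSum _ fun i _ => integrable_finsetSum _ fun j _ => hp i j j i)]
    congr 1
    funext x
    rw [EuclideanSpace.norm_sq_eq, EuclideanSpace.norm_sq_eq]
    simpa [gradV, curl] using
      sum_sq_eq_sum_lt_sub_sq_add fun i j => weakDeriv Ω i (fun y => v y j) x
  have e2 : l2sq Ω (divg Ω v) = ∫ x in Ω, ∑ i, ∑ j, weakDeriv Ω j (fun y => v y j) x
        * weakDeriv Ω i (fun y => v y i) x := by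
    unfold l2sq divg
    congr 1
    funext x
    rw [Real.norm_eq_abs, sq_abs, sq, Finset.sum_mul_sum, Finset.sum_comm]
  rw [e1, e2]
  congr 1
  rw [integral_finsetSum _ fun i _ => integrable_finsetSum _ fun j _ => hp i j j i,
    integral_finsetSum _ fun i _ => integrable_finsetSum _ fun j _ => hp j j i i]
  refine Finset.sum_congr rfl fun i _ => ?_
  rw [integral_finsetSum _ fun j _ => hp i j j i, integral_finsetSum _ fun j _ => hp j j i i]
  -- Exchanging ∂_i and ∂_j turns ∂_i v_j ∂_j v_i into ∂_j v_j ∂_i v_i under the integral.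
  exact Finset.sum_congr rfl fun j _ =>
    (hv i).integral_weakDeriv_mul_weakDeriv_comm (hv j).1 i j

theorem ZeroNormalTrace.l2inner_grad {v : E m → E m} {f : E m → ℝ} (h : ZeroNormalTrace Ω v)
    (hdiv : ∀ᵐ x ∂(volume.restrict Ω), divg Ω v x = 0) (hf : MemH1 Ω f) :
    l2inner Ω v (grad Ω f) = 0 := by
  have h0 : l2inner Ω (divg Ω v) f = 0 := by
    refine integral_eq_zero_of_ae ?_
    filter_upwards [hdiv] with x hx
    simp [hx]
  linarith [h f hf]

theorem inner_gradT (d w v : E m → E m) (x : E m) :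
    inner ℝ (gradT Ω d w x) (v x) = inner ℝ (conv Ω v d x) (w x) := by
  simp only [gradT, conv, PiLp.inner_apply, RCLike.inner_apply, conj_trivial, Finset.mul_sum]
  rw [Finset.sum_comm]
  exact Finset.sum_congr rfl fun i _ => Finset.sum_congr rfl fun j _ => by ring

/-- Identifies the elastic force tested with u_* with the matching term of the scalar equation. -/
theorem l2inner_gradT (d w v : E m → E m) :
    l2inner Ω (gradT Ω d w) v = l2inner Ω (conv Ω v d) w := by
  simp only [l2inner, inner_gradT]

/-! ### Discrete operators and gradients -/

theorem bdf_eq_linearComb {V : Type*} [AddCommGroup V] [Module ℝ V] (f : ℕ → V) (n : ℕ) :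
    bdf f n = (1 : ℝ) • ((3 : ℝ) • f (n + 1) + (-4 : ℝ) • f n) + (1 : ℝ) • f (n - 1) := by
  rw [bdf]
  module

theorem extrap_eq_linearComb {V : Type*} [AddCommGroup V] [Module ℝ V] (f : ℕ → V) (n : ℕ) :
    extrap f n = (2 : ℝ) • f n + (-1 : ℝ) • f (n - 1) := by
  rw [extrap]
  module

theorem memH1V_bdf (hΩ : IsOpen Ω) {d : ℕ → E m → E m} {n : ℕ} (h2 : MemH1V Ω (d (n + 1)))
    (h1 : MemH1V Ω (d n)) (h0 : MemH1V Ω (d (n - 1))) : MemH1V Ω (bdf d n) := by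
  rw [bdf_eq_linearComb]
  exact (h2.linearComb hΩ _ _ h1).linearComb hΩ _ _ h0

theorem gradV_bdf (hΩ : IsOpen Ω) {d : ℕ → E m → E m} {n : ℕ} (h2 : MemH1V Ω (d (n + 1)))
    (h1 : MemH1V Ω (d n)) (h0 : MemH1V Ω (d (n - 1))) :
    gradV Ω (bdf d n) =ᵐ[volume.restrict Ω] bdf (fun k => gradV Ω (d k)) n := by
  rw [bdf_eq_linearComb, bdf_eq_linearComb]
  filter_upwards [(h2.linearComb hΩ 3 (-4) h1).gradV_linearComb hΩ 1 1 h0,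
    h2.gradV_linearComb hΩ 3 (-4) h1] with x e1 e2
  simp only [Pi.add_apply, Pi.smul_apply] at e1 e2 ⊢
  rw [e1, e2]

theorem gradV_extrap (hΩ : IsOpen Ω) {d : ℕ → E m → E m} {n : ℕ} (h1 : MemH1V Ω (d n))
    (h0 : MemH1V Ω (d (n - 1))) :
    gradV Ω (extrap d n) =ᵐ[volume.restrict Ω] extrap (fun k => gradV Ω (d k)) n := by
  rw [extrap_eq_linearComb, extrap_eq_linearComb]
  exact h1.gradV_linearComb hΩ 2 (-1) h0

end PCSAV

namespace PCSAV

variable {m : ℕ} {Ω : Set (E m)} {P : Params} {I : Iterates m} {n : ℕ}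

/-! ### The energy estimate -/

theorem Params.dt_pos (P : Params) : 0 < P.dt :=
  div_pos P.T_pos (Nat.cast_pos.2 P.N_pos)

theorem Params.e_pos (P : Params) (n : ℕ) : 0 < P.e n := Real.exp_pos _

theorem gSeq_succ_eq_linearComb (n : ℕ) :
    gSeq Ω P I (n + 1) = P.ν • divg Ω (I.ustar (n + 1)) + (1 : ℝ) • gSeq Ω P I n := by
  funext x
  simp [gSeq]

theorem hSeq_succ_eq_linearComb (n : ℕ) :
    hSeq Ω P I (n + 1) = fun x => 1 * hSeq Ω P I n x + 1 * pressureIncr Ω P I n x := by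
  funext x
  simp only [hSeq, gSeq, pressureIncr]
  ring

/-- The increments of H lie in H^1 by the projection step, whereas p and g separately are only known
to be in L². -/
theorem IsSolution.memH1_hSeq (hI : IsSolution Ω P I) (hΩ : IsOpen Ω) :
    ∀ n, 1 ≤ n → n ≤ P.N → MemH1 Ω (hSeq Ω P I n) := by
  intro n hn
  induction n, hn using Nat.le_induction with
  | base => exact fun _ => hI.start_mem
  | succ n hn ih =>
    intro hN
    rw [hSeq_succ_eq_linearComb]
    exact (ih (Nat.le_of_succ_le hN)).linearComb hΩ 1 1 (hI.step n hn hN).incr_mem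

theorem IsSolution.memLp_gSeq (hI : IsSolution Ω P I) :
    ∀ n ≤ P.N, MemLp (gSeq Ω P I n) 2 (volume.restrict Ω) := by
  intro n
  induction n with
  | zero => exact fun _ => MemLp.zero
  | succ n ih =>
    intro hN
    rw [gSeq_succ_eq_linearComb]
    exact ((hI.ustar_mem (n + 1) n.succ_pos hN).memH1V.memLp_divg.const_smul P.ν).add
      ((ih (Nat.le_of_succ_le hN)).const_smul (1 : ℝ))

/-! ### Projection step and pressure terms -/

theorem IsStep.ustar_ae_eq (h : IsStep Ω P I n) :
    I.ustar (n + 1) =ᵐ[volume.restrict Ω]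
      (1 : ℝ) • I.u (n + 1) + (2 * P.dt / 3) • grad Ω (pressureIncr Ω P I n) := by
  have hdt := P.dt_pos
  filter_upwards [h.correction] with x hx
  simp only [Pi.add_apply, Pi.smul_apply]
  have e : (2 * P.dt / 3) • ((1 / (2 * P.dt)) • ((3 : ℝ) • I.u (n + 1) x
      - (3 : ℝ) • I.ustar (n + 1) x)) = I.u (n + 1) x - I.ustar (n + 1) x := by
    rw [smul_smul, ← smul_sub, smul_smul]
    have : 2 * P.dt / 3 * (1 / (2 * P.dt)) * 3 = 1 := by field_simp
    rw [this, one_smul]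
  have := congrArg (fun y => (2 * P.dt / 3) • y) hx
  simp only [smul_add, smul_zero, e] at this
  rw [one_smul, ← sub_eq_zero, ← neg_eq_zero, ← this]
  abel

theorem IsStep.bdfStar_ae_eq (h : IsStep Ω P I n) :
    bdfStar I n =ᵐ[volume.restrict Ω]
      (1 : ℝ) • bdf I.u n + (2 * P.dt) • grad Ω (pressureIncr Ω P I n) := by
  filter_upwards [h.ustar_ae_eq] with x hx
  simp only [bdfStar, bdf, Pi.add_apply, Pi.sub_apply, Pi.smul_apply] at hx ⊢
  rw [hx]
  module

/-- Both factors are a solenoidal field plus a multiple of ∇Φ, so the cross terms vanish, and 4τ²/3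
is the product of the multiples 2τ and 2τ/3. -/
theorem IsSolution.l2inner_bdfStar (hI : IsSolution Ω P I) (h1 : 1 ≤ n) (hn : n < P.N) :
    l2inner Ω (bdfStar I n) (I.ustar (n + 1))
      = l2inner Ω (bdf I.u n) (I.u (n + 1))
        + 4 * P.dt ^ 2 / 3 * l2sq Ω (grad Ω (pressureIncr Ω P I n)) := by
  have hs := hI.step n h1 hn
  have hn0 : n - 1 ≤ P.N := by omega
  have orth : ∀ k ≤ P.N, l2inner Ω (I.u k) (grad Ω (pressureIncr Ω P I n)) = 0 := fun k hk =>
    (hI.u_normal k hk).l2inner_grad (hI.u_divFree k hk) hs.incr_mem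
  have hg := hs.incr_mem.memLp_grad
  have hu2 := hI.u_mem (n + 1) hn
  have hu1 := hI.u_mem n hn.le
  have hu0 := hI.u_mem (n - 1) hn0
  have hb := memLp_bdf hu2 hu1 hu0
  have orth_bdf : l2inner Ω (bdf I.u n) (grad Ω (pressureIncr Ω P I n)) = 0 := by
    rw [bdf_eq_linearComb, l2inner_linearComb_left _ _
        (pairs_of_memLp ((hu2.const_smul (3 : ℝ)).add (hu1.const_smul (-4 : ℝ))) hg)
        (pairs_of_memLp hu0 hg),
      l2inner_linearComb_left _ _ (pairs_of_memLp hu2 hg) (pairs_of_memLp hu1 hg),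
      orth _ hn, orth _ hn.le, orth _ hn0]
    ring
  have hsum := (hu2.const_smul (1 : ℝ)).add (hg.const_smul (2 * P.dt / 3))
  rw [l2inner_congr hs.bdfStar_ae_eq hs.ustar_ae_eq,
    l2inner_linearComb_left _ _ (pairs_of_memLp hb hsum) (pairs_of_memLp hg hsum),
    l2inner_linearComb_right _ _ (pairs_of_memLp hb hu2) (pairs_of_memLp hb hg),
    l2inner_linearComb_right _ _ (pairs_of_memLp hg hu2) (pairs_of_memLp hg hg),
    orth_bdf, l2inner_comm (grad Ω _) (I.u (n + 1)), orth (n + 1) hn, l2inner_self]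
  ring

/-- With p^n = H^n - g^n, the H part can be integrated by parts, and only the gradient part of
u_*^{n+1} sees ∇H^n. -/
theorem IsSolution.l2inner_pressure (hI : IsSolution Ω P I) (hΩ : IsOpen Ω) (h1 : 1 ≤ n)
    (hn : n < P.N) :
    l2inner Ω (I.p n) (divg Ω (I.ustar (n + 1)))
      = - (2 * P.dt / 3 * l2inner Ω (grad Ω (hSeq Ω P I n)) (grad Ω (pressureIncr Ω P I n)))
        - l2inner Ω (gSeq Ω P I n) (divg Ω (I.ustar (n + 1))) := by
  have hs := hI.step n h1 hn
  have hH := hI.memH1_hSeq hΩ n h1 hn.le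
  have hg := hI.memLp_gSeq n hn.le
  have hv := hI.ustar_mem (n + 1) n.succ_pos hn
  have hdiv := hv.memH1V.memLp_divg
  have hu := hI.u_mem (n + 1) hn
  have hp : I.p n = (1 : ℝ) • hSeq Ω P I n + (-1 : ℝ) • gSeq Ω P I n := by
    funext x
    simp [hSeq]
  have orth : l2inner Ω (I.u (n + 1)) (grad Ω (hSeq Ω P I n)) = 0 :=
    (hI.u_normal _ hn).l2inner_grad (hI.u_divFree _ hn) hH
  rw [hp, l2inner_linearComb_left _ _ (pairs_of_memLp hH.1 hdiv) (pairs_of_memLp hg hdiv),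
    hv.l2inner_divg hH, l2inner_congr (EventuallyEq.refl _ _) hs.ustar_ae_eq,
    l2inner_linearComb_right _ _ (pairs_of_memLp hH.memLp_grad hu)
      (pairs_of_memLp hH.memLp_grad hs.incr_mem.memLp_grad),
    l2inner_comm _ (I.u (n + 1)), orth]
  ring

theorem IsSolution.l2sq_grad_hSeq_succ (hI : IsSolution Ω P I) (hΩ : IsOpen Ω) (h1 : 1 ≤ n)
    (hn : n < P.N) :
    l2sq Ω (grad Ω (hSeq Ω P I (n + 1)))
      = l2sq Ω (grad Ω (hSeq Ω P I n))
        + 2 * l2inner Ω (grad Ω (hSeq Ω P I n)) (grad Ω (pressureIncr Ω P I n))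
        + l2sq Ω (grad Ω (pressureIncr Ω P I n)) := by
  have hs := (hI.step n h1 hn).incr_mem
  have hH := hI.memH1_hSeq hΩ n h1 hn.le
  rw [hSeq_succ_eq_linearComb, l2sq_congr (hH.grad_linearComb hΩ 1 1 hs),
    l2sq_linearComb _ _ hH.memLp_grad hs.memLp_grad]
  ring

theorem IsSolution.l2sq_gSeq_succ (hI : IsSolution Ω P I) (hn : n < P.N) :
    l2sq Ω (gSeq Ω P I (n + 1))
      = l2sq Ω (gSeq Ω P I n) + 2 * P.ν * l2inner Ω (gSeq Ω P I n) (divg Ω (I.ustar (n + 1)))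
        + P.ν ^ 2 * l2sq Ω (divg Ω (I.ustar (n + 1))) := by
  rw [gSeq_succ_eq_linearComb, l2sq_linearComb _ _
    (hI.ustar_mem (n + 1) n.succ_pos hn).memH1V.memLp_divg (hI.memLp_gSeq n hn.le), l2inner_comm]
  ring

/-! ### Director and multiplier -/

theorem IsSolution.l2inner_director (hI : IsSolution Ω P I) (h1 : 1 ≤ n) (hn : n < P.N) :
    1 / (2 * P.dt) * l2inner Ω (bdf I.d n) (I.w (n + 1))
      + savFactor P I n * l2inner Ω (conv Ω (extrap I.u n) (extrap I.d n)) (I.w (n + 1))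
      + P.γ * l2sq Ω (I.w (n + 1)) = 0 := by
  have hs := hI.step n h1 hn
  have hw := hI.w_mem (n + 1) hn
  have hb := memLp_bdf (hI.d_mem (n + 1) hn).memLp (hI.d_mem n hn.le).memLp
    (hI.d_mem (n - 1) (by omega)).memLp
  have i1 := (pairs_of_memLp hb hw).const_mul (1 / (2 * P.dt))
  -- The convective product is integrable by assumption; the L² and H^1 bounds alone would not give
  -- it.
  have i2 := hs.sav_pairs.const_mul (savFactor P I n)
  have i3 := (integrable_norm_sq hw).const_mul P.γ
  unfold l2inner l2sq
  rw [← integral_const_mul, ← integral_const_mul, ← integral_const_mul, ← integral_add i1 i2]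
  have i12 : Integrable (fun x => 1 / (2 * P.dt) * inner ℝ (bdf I.d n x) (I.w (n + 1) x)
    + savFactor P I n * inner ℝ (conv Ω (extrap I.u n) (extrap I.d n) x) (I.w (n + 1) x))
    (volume.restrict Ω) := i1.add i2
  rw [← integral_add i12 i3]
  refine integral_eq_zero_of_ae ?_
  filter_upwards [hs.director] with x hx
  have := congrArg (fun y => inner ℝ y (I.w (n + 1) x)) hx
  simpa only [inner_add_left, real_inner_smul_left, inner_zero_left, real_inner_self_eq_norm_sq,
    Pi.zero_apply]
    using this

theorem IsSolution.l2inner_chemical (hI : IsSolution Ω P I) (hΩ : IsOpen Ω) (h1 : 1 ≤ n)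
    (hn : n < P.N) :
    l2inner Ω (bdf I.d n) (I.w (n + 1))
      = l2inner Ω (bdf (fun k => gradV Ω (I.d k)) n) (gradV Ω (I.d (n + 1)))
        + P.ε ^ 2 / 2 * l2inner Ω (bdf I.q n) (I.q (n + 1)) := by
  have hs := hI.step n h1 hn
  have hd2 := hI.d_mem (n + 1) hn
  have hd1 := hI.d_mem n hn.le
  have hd0 := hI.d_mem (n - 1) (by omega)
  have hε := P.ε_pos
  have hdt := P.dt_pos
  -- The multiplier equation is the discrete chain rule for the penalty: it turns the coupling term
  -- into a backward difference of q tested with q.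
  have e : l2inner Ω (fun x => I.q (n + 1) x • extrap I.d n x) (bdf I.d n)
      = P.ε ^ 2 / 2 * l2inner Ω (bdf I.q n) (I.q (n + 1)) := by
    unfold l2inner
    rw [← integral_const_mul]
    refine integral_congr_ae ?_
    filter_upwards [hs.multiplier] with x hx
    rw [real_inner_smul_right] at hx
    have hx' : bdf I.q n x = 2 / P.ε ^ 2 * inner ℝ (extrap I.d n x) (bdf I.d n x) := by
      field_simp at hx ⊢
      linarith
    simp only [real_inner_smul_left, RCLike.inner_apply, conj_trivial, hx']
    field_simp
  rw [l2inner_comm, (hs.chemical _ (memH1V_bdf hΩ hd2 hd1 hd0)).2, e,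
    l2inner_congr (EventuallyEq.refl _ _) (gradV_bdf hΩ hd2 hd1 hd0), l2inner_comm]

/-- C₁, C₂, C₃ stand for the velocity convection, elastic force and director convection terms. They
cancel when the three equations are weighted by 2τ, 2τλ and 2τλs. -/
theorem energy_balance {τ ν lam γ ε T e s B U Φ C₁ C₂ C₃ G HΦ gd D Q W : ℝ} (hτ : τ ≠ 0)
    (hlam : lam ≠ 0) (he : e ≠ 0)
    (hmom : 1 / (2 * τ) * (U + 4 * τ ^ 2 / 3 * Φ) + s / e * C₁ + ν * G
      - (-(2 * τ / 3 * HΦ) - gd) = lam * (s / e) * C₂)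
    (hdir : 1 / (2 * τ) * (D + ε ^ 2 / 2 * Q) + s / e * C₃ + γ * W = 0)
    (hsav : B / (2 * τ) = -(s / T) + 1 / e * C₃ - 1 / e * C₂ + 1 / lam * (1 / e) * C₁) :
    U + 4 * τ ^ 2 / 3 * Φ + 2 * τ * ν * G + 4 * τ ^ 2 / 3 * HΦ + 2 * τ * gd
      + lam * D + lam * ε ^ 2 / 2 * Q + 2 * τ * lam * γ * W + lam * (B * s)
      + 2 * τ * lam * s ^ 2 / T = 0 := by
  have hB : lam * (B * s) = 2 * τ * lam * s * (B / (2 * τ)) := by field_simp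
  have hA : U + 4 * τ ^ 2 / 3 * Φ
      = 2 * τ * (1 / (2 * τ) * (U + 4 * τ ^ 2 / 3 * Φ)) := by field_simp
  have hD : lam * D + lam * ε ^ 2 / 2 * Q
      = 2 * τ * lam * (1 / (2 * τ) * (D + ε ^ 2 / 2 * Q)) := by field_simp
  have h1 : lam * (1 / lam * (1 / e) * C₁) = 1 / e * C₁ := by field_simp
  rw [hsav] at hB
  linear_combination hA + hD + hB + 2 * τ * hmom + 2 * τ * lam * hdir + 2 * τ * s * h1

end PCSAV

theorem theorem3p1 (m : ℕ) (hm : m = 2 ∨ m = 3) (Ω : Set (E m)) (hΩ : IsOpen Ω)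
    (hΩb : Bornology.IsBounded Ω) (P : Params) (I : Iterates m) (hI : IsSolution Ω P I) :
    (∀ n, 1 ≤ n → n ≤ P.N → MemH1 Ω (hSeq Ω P I n)) ∧
    ∀ n, 1 ≤ n → n < P.N →
      energy Ω P I (n + 1)
        + 2 * P.dt * P.lam * P.γ * l2sq Ω (I.w (n + 1))
        + P.ν * P.dt * l2sq Ω (gradV Ω (I.ustar (n + 1)))
        + P.ν * P.dt * l2sq Ω (curl Ω (I.ustar (n + 1)))
        + P.lam * (2 * P.dt / P.T) * |I.s (n + 1)| ^ 2
      ≤ energy Ω P I n := by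
  refine ⟨hI.memH1_hSeq hΩ, fun n h1 hn => ?_⟩
  have hn0 : n - 1 ≤ P.N := by omega
  have hs := hI.step n h1 hn
  have hv := hI.ustar_mem (n + 1) n.succ_pos hn
  have hd2 := hI.d_mem (n + 1) hn
  have hd1 := hI.d_mem n hn.le
  have hd0 := hI.d_mem (n - 1) hn0
  have hτ := P.dt_pos
  have hν := P.ν_pos
  have hlam := P.lam_pos
  have he := P.e_pos (n + 1)
  have hmom := (hs.momentum _ hv).2.2
  rw [hI.l2inner_bdfStar h1 hn, hI.l2inner_pressure hΩ h1 hn, l2inner_gradT, l2inner_self] at hmom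
  have hdir := hI.l2inner_director h1 hn
  rw [hI.l2inner_chemical hΩ h1 hn] at hdir
  have hsav := hs.sav
  have hU := le_two_mul_l2inner_bdf (hI.u_mem (n + 1) hn) (hI.u_mem n hn.le)
    (hI.u_mem (n - 1) hn0)
  have hQ := le_two_mul_l2inner_bdf (hI.q_mem (n + 1) hn) (hI.q_mem n hn.le)
    (hI.q_mem (n - 1) hn0)
  have hD := le_two_mul_l2inner_bdf (f := fun k => gradV Ω (I.d k)) hd2.memLp_gradV
    hd1.memLp_gradV hd0.memLp_gradV
  have hS : (3 * I.s (n + 1) - 4 * I.s n + I.s (n - 1)) * I.s (n + 1) * 2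
      ≥ I.s (n + 1) ^ 2 + (2 * I.s (n + 1) - I.s n) ^ 2 - I.s n ^ 2
        - (2 * I.s n - I.s (n - 1)) ^ 2 := by
    nlinarith [sq_nonneg (I.s (n + 1) - 2 * I.s n + I.s (n - 1))]
  have hΦ := l2sq_nonneg (Ω := Ω) (grad Ω (pressureIncr Ω P I n))
  have hG := hv.l2sq_gradV
  have hH := hI.l2sq_grad_hSeq_succ hΩ h1 hn
  have hg := hI.l2sq_gSeq_succ hn
  have hE2 : l2sq Ω (gradV Ω (extrap I.d (n + 1)))
      = l2sq Ω (extrap (fun k => gradV Ω (I.d k)) (n + 1)) :=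
    l2sq_congr (gradV_extrap hΩ hd2 hd1)
  have hE1 : l2sq Ω (gradV Ω (extrap I.d n)) = l2sq Ω (extrap (fun k => gradV Ω (I.d k)) n) :=
    l2sq_congr (gradV_extrap hΩ hd1 hd0)
  have hx2 : extrap I.s (n + 1) = 2 * I.s (n + 1) - I.s n := rfl
  have hx1 : extrap I.s n = 2 * I.s n - I.s (n - 1) := rfl
  have balance := energy_balance hτ.ne' hlam.ne' he.ne' hmom hdir hsav
  have hD' := mul_le_mul_of_nonneg_left hD hlam.le
  have hQ' := mul_le_mul_of_nonneg_left hQ (by positivity : 0 ≤ P.lam * P.ε ^ 2 / 2)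
  have hS' := mul_le_mul_of_nonneg_left hS hlam.le
  -- What remains of 4τ²/3 ‖∇Φ‖² after 2τ²/3 of it completes the square in ‖∇H^{n+1}‖².
  have hΦ' : 0 ≤ 2 / 3 * P.dt ^ 2 * l2sq Ω (grad Ω (pressureIncr Ω P I n)) := by positivity
  -- The weight τ/ν makes the cross term equal to the contribution of g^n to the balance.
  have hg' : P.ν⁻¹ * P.dt * l2sq Ω (gSeq Ω P I (n + 1))
      = P.ν⁻¹ * P.dt * l2sq Ω (gSeq Ω P I n)
        + 2 * P.dt * l2inner Ω (gSeq Ω P I n) (divg Ω (I.ustar (n + 1)))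
        + P.ν * P.dt * l2sq Ω (divg Ω (I.ustar (n + 1))) := by
    rw [hg]
    field_simp
  have hsT : P.lam * (2 * P.dt / P.T) * I.s (n + 1) ^ 2
      = 2 * P.dt * P.lam * I.s (n + 1) ^ 2 / P.T := by ring
  unfold energy
  rw [hE1, hE2, hx1, hx2, hg', hH]
  simp only [sq_abs]
  rw [hsT]
  -- The viscous terms now match exactly: 2ντ(‖∇×u_*‖² + ‖∇·u_*‖²) in the balance and, counting the
  -- divergence term from g^{n+1}, in the goal.
  rw [hG] at balance ⊢
  linarith
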